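/- Let $d\ge 0$ be an integer and let $\mathcal H$ be a complex Hilbert space with $\mathcal H\ne\{0\}$ which is continuously embedded in the space $\mathscr S'(\mathbf R^d)$ of tempered distributions. Suppose that there is a constant $C_0\ge 1$ such that for all $f\in\mathcal H$ and all $x,\xi\in\mathbf R^d$ the tempered distribution $e^{i\langle\,\cdot\,,\xi\rangle}f(\,\cdot\,-x)$ belongs to $\mathcal H$ and $$\|e^{i\langle\,\cdot\,,\xi\rangle}f(\,\cdot\,-x)\|_{\mathcal H}\le C_0\|f\|_{\mathcal H}.$$ Then $\mathcal H=L^2(\mathbf R^d)$ as subspaces of $\mathscr S'(\mathbf R^d)$, and there is a constant $C>0$, independent of $f$, such that $$C_0^{-1}C\|f\|_{L^2(\mathbf R^d)}\le\|f\|_{\mathcal H}\le C_0C\|f\|_{L^2(\mathbf R^d)}\qquad\text{for all } f\in\mathcal H=L^2(\mathbf R^d).$$ -/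

import Mathlib

open MeasureTheory SchwartzMap

/-- The character `y ↦ e^{i⟨y, ξ⟩}` on `ℝ^d`. -/
noncomputable def expChar {d : ℕ} (ξ : EuclideanSpace ℝ (Fin d)) :
    EuclideanSpace ℝ (Fin d) → ℂ :=
  fun y => Complex.exp (Complex.I * ((inner ℝ y ξ : ℝ) : ℂ))

/-- Characters have temperate growth, so multiplying a tempered distribution by one is
meaningful (Mathlib's `smulLeftCLM` is the genuine multiplication operator for them). -/
theorem expChar_hasTemperateGrowth {d : ℕ} (ξ : EuclideanSpace ℝ (Fin d)) :
    (expChar ξ).HasTemperateGrowth := by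
  have h1 : (fun t : ℝ => Complex.exp (Complex.I * (t : ℂ))).HasTemperateGrowth := by
    have hd : ∀ n : ℕ, iteratedDeriv n (fun t : ℝ => Complex.exp (Complex.I * (t : ℂ))) =
        fun t : ℝ => Complex.I ^ n * Complex.exp (Complex.I * (t : ℂ)) := by
      intro n
      induction n with
      | zero => simp
      | succ n ih =>
        rw [iteratedDeriv_succ, ih]
        funext t
        have h := (((hasDerivAt_id (t : ℂ)).const_mul Complex.I).cexp.const_mul
          (Complex.I ^ n)).comp_ofReal
        simp only [id] at h
        rw [h.deriv]
        ring
    refine ⟨Complex.contDiff_exp.comp (contDiff_const.mul Complex.ofRealCLM.contDiff),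
      fun n => ⟨0, 1, fun t => ?_⟩⟩
    rw [norm_iteratedFDeriv_eq_norm_iteratedDeriv, hd]
    simp [mul_comm Complex.I, Complex.norm_exp_ofReal_mul_I]
  have h2 : (fun y : EuclideanSpace ℝ (Fin d) => (inner ℝ y ξ : ℝ)).HasTemperateGrowth := by
    fun_prop
  exact h1.comp h2

/-- The translation `f ↦ f(· - x)` of tempered distributions:
`⟨f(· - x), φ⟩ = ⟨f, φ(· + x)⟩`. -/
noncomputable def translateTD {d : ℕ} (x : EuclideanSpace ℝ (Fin d)) :
    𝓢'(EuclideanSpace ℝ (Fin d), ℂ) →L[ℂ] 𝓢'(EuclideanSpace ℝ (Fin d), ℂ) :=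
  PointwiseConvergenceCLM.precomp ℂ (SchwartzMap.compSubConstCLM ℂ (-x))

/-- The modulation `f ↦ e^{i⟨·, ξ⟩} f` of tempered distributions:
`⟨e^{i⟨·, ξ⟩} f, φ⟩ = ⟨f, e^{i⟨·, ξ⟩} φ⟩`. -/
noncomputable def modulateTD {d : ℕ} (ξ : EuclideanSpace ℝ (Fin d)) :
    𝓢'(EuclideanSpace ℝ (Fin d), ℂ) →L[ℂ] 𝓢'(EuclideanSpace ℝ (Fin d), ℂ) :=
  TemperedDistribution.smulLeftCLM ℂ (expChar ξ)

/-- Finite averages on an abelian group that are invariant up to `2 C / n` under finitely many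
translations. -/
theorem exists_almost_invariant_average {G : Type*} [AddCommGroup G] (n : ℕ) (hn : 0 < n)
    (s : Finset G) :
    ∃ m : (G → ℂ) →ₗ[ℂ] ℂ,
      (∀ (K : Set ℂ) (h : G → ℂ), Convex ℝ K → (∀ g, h g ∈ K) → m h ∈ K) ∧
      (∀ h : G → ℂ, m (star h) = star (m h)) ∧
      ∀ a ∈ s, ∀ (h : G → ℂ) (C : ℝ), (∀ g, ‖h g‖ ≤ C) →
        ‖m (fun g => h (g + a)) - m h‖ ≤ 2 * C / n := by
  classical
  have hn' : (0 : ℝ) < n := by exact_mod_cast hn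
  have key : ∀ (m : (G → ℂ) →ₗ[ℂ] ℂ),
      (∀ (K : Set ℂ) (h : G → ℂ), Convex ℝ K → (∀ g, h g ∈ K) → m h ∈ K) →
      ∀ (h : G → ℂ) (C : ℝ), (∀ g, ‖h g‖ ≤ C) → ‖m h‖ ≤ C := by
    intro m hm h C hC
    have := hm (Metric.closedBall 0 C) h (convex_closedBall _ _) (by simpa using hC)
    simpa using this
  induction s using Finset.induction_on with
  | empty =>
    exact ⟨LinearMap.proj 0, fun K h _ hh => hh 0, fun h => rfl, by simp⟩
  | insert a s has ih =>
    obtain ⟨m, hm, hstar, hinv⟩ := ih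
    -- `m'` averages `m` over the shifts by `k • a`, `k < n`. For `a` itself the sum telescopes to
    -- two end terms, whence `2 * C / n`; for older translations the inductive bound applies to each
    -- shifted function, because shifts commute.
    let sh : ℕ → (G → ℂ) →ₗ[ℂ] (G → ℂ) := fun k => LinearMap.funLeft ℂ ℂ (fun g => g + k • a)
    have hsh : ∀ k h g, sh k h g = h (g + k • a) := fun k h g => rfl
    let m' : (G → ℂ) →ₗ[ℂ] ℂ := ((n : ℝ)⁻¹ : ℂ) • ∑ k ∈ Finset.range n, m ∘ₗ sh k
    have hm'a : ∀ h, m' h = ((n : ℝ)⁻¹ : ℂ) * ∑ k ∈ Finset.range n, m (sh k h) := by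
      intro h
      simp [m']
    refine ⟨m', ?_, ?_, ?_⟩
    · intro K h hK hh
      have : m' h = ∑ k ∈ Finset.range n, (n : ℝ)⁻¹ • m (sh k h) := by
        rw [hm'a, Finset.mul_sum]
        simp [Complex.real_smul]
      rw [this]
      refine hK.sum_mem (fun _ _ => by positivity) ?_ (fun k _ => hm K _ hK fun g => hh _)
      simp [hn.ne']
    · intro h
      rw [hm'a, hm'a]
      simp only [star_mul', star_sum, ← hstar]
      congr 1
      simp
    · intro b hb h C hC
      have hC0 : 0 ≤ C := (norm_nonneg _).trans (hC 0)
      rcases Finset.mem_insert.1 hb with rfl | hb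
      · have h1 : ∀ k, sh k (fun g => h (g + b)) = sh (k + 1) h := by
          intro k
          funext g
          simp only [hsh]
          congr 1
          rw [succ_nsmul]
          abel
        rw [hm'a, hm'a, ← mul_sub, ← Finset.sum_sub_distrib]
        simp only [h1]
        rw [Finset.sum_range_sub (fun k => m (sh k h)), norm_mul]
        have h2 : ‖m (sh n h) - m (sh 0 h)‖ ≤ 2 * C := by
          refine (norm_sub_le _ _).trans ?_
          have := key m hm (sh n h) C (fun g => hC _)
          have := key m hm (sh 0 h) C (fun g => hC _)
          linarith
        have h3 : ‖((n : ℝ)⁻¹ : ℂ)‖ = (n : ℝ)⁻¹ := by simp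
        rw [h3, div_eq_inv_mul]
        gcongr
      · have h1 : ∀ k, sh k (fun g => h (g + b)) = fun g => sh k h (g + b) := by
          intro k
          funext g
          simp only [hsh]
          congr 1
          abel
        rw [hm'a, hm'a, ← mul_sub, ← Finset.sum_sub_distrib, norm_mul]
        simp only [h1]
        have h2 : ‖∑ k ∈ Finset.range n, (m (fun g => sh k h (g + b)) - m (sh k h))‖
            ≤ ∑ k ∈ Finset.range n, 2 * C / n :=
          norm_sum_le_of_le _ fun k _ => hinv b hb (sh k h) C fun g => hC _
        have h3 : ‖((n : ℝ)⁻¹ : ℂ)‖ = (n : ℝ)⁻¹ := by simp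
        rw [h3]
        calc _ ≤ (n : ℝ)⁻¹ * ∑ k ∈ Finset.range n, 2 * C / n := by gcongr
          _ = 2 * C / n := by
            simp only [Finset.sum_const, Finset.card_range, nsmul_eq_mul]
            field_simp

open Filter Topology in
/-- Abelian groups are amenable: there is an invariant mean on bounded functions. -/
theorem exists_invariant_mean (G : Type*) [AddCommGroup G] :
    ∃ m : (G → ℂ) → ℂ,
      (∀ (h₁ h₂ : G → ℂ) (C : ℝ), (∀ g, ‖h₁ g‖ ≤ C) → (∀ g, ‖h₂ g‖ ≤ C) →
        m (h₁ + h₂) = m h₁ + m h₂) ∧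
      (∀ (c : ℂ) (h : G → ℂ) (C : ℝ), (∀ g, ‖h g‖ ≤ C) → m (c • h) = c * m h) ∧
      (∀ (h : G → ℂ) (C : ℝ), (∀ g, ‖h g‖ ≤ C) → m (star h) = star (m h)) ∧
      (∀ (K : Set ℂ) (h : G → ℂ) (C : ℝ), (∀ g, ‖h g‖ ≤ C) → Convex ℝ K → IsClosed K →
        (∀ g, h g ∈ K) → m h ∈ K) ∧
      ∀ (a : G) (h : G → ℂ) (C : ℝ), (∀ g, ‖h g‖ ≤ C) → m (fun g => h (g + a)) = m h := by
  classical
  choose A hA hstar hinv using fun p : Finset G × ℕ =>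
    exists_almost_invariant_average (p.2 + 1) (Nat.succ_pos _) p.1
  -- Along an ultrafilter all bounded averages converge, by compactness of discs. As it refines
  -- `atTop`, each translation eventually lies in `p.1` while the error `2 * C / (p.2 + 1)` tends to
  -- zero.
  let U : Ultrafilter (Finset G × ℕ) := Ultrafilter.of atTop
  have hU : (U : Filter (Finset G × ℕ)) ≤ atTop := Ultrafilter.of_le _
  have key : ∀ (h : G → ℂ) (C : ℝ), (∀ g, ‖h g‖ ≤ C) →
      Tendsto (fun p => A p h) U (𝓝 (limUnder U (fun p => A p h))) := by
    intro h C hC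
    have hmem : ∀ p, A p h ∈ Metric.closedBall (0 : ℂ) C := fun p =>
      hA p _ h (convex_closedBall _ _) (by simpa using hC)
    obtain ⟨x, -, hx⟩ := (isCompact_closedBall (0 : ℂ) C).ultrafilter_le_nhds'
      (U.map (fun p => A p h)) (Ultrafilter.mem_map.2 (Filter.Eventually.of_forall hmem))
    exact tendsto_nhds_limUnder ⟨x, hx⟩
  refine ⟨fun h => limUnder U (fun p => A p h), ?_, ?_, ?_, ?_, ?_⟩
  · intro h₁ h₂ C hC₁ hC₂
    refine tendsto_nhds_unique (key (h₁ + h₂) (C + C) fun g => ?_) ?_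
    · exact norm_add_le_of_le (hC₁ g) (hC₂ g)
    · simpa using (key h₁ C hC₁).add (key h₂ C hC₂)
  · intro c h C hC
    refine tendsto_nhds_unique (key (c • h) (‖c‖ * C) fun g => ?_) ?_
    · simpa using mul_le_mul_of_nonneg_left (hC g) (norm_nonneg c)
    · simpa using (key h C hC).const_mul c
  · intro h C hC
    refine tendsto_nhds_unique (key (star h) C fun g => ?_) ?_
    · simpa using hC g
    · simpa [hstar] using (key h C hC).star
  · intro K h C hC hK hcl hh
    exact hcl.mem_of_tendsto (key h C hC) (Filter.Eventually.of_forall fun p => hA p K h hK hh)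
  · intro a h C hC
    have h0 : Tendsto (fun p => A p (fun g => h (g + a)) - A p h) U (𝓝 0) := by
      refine squeeze_zero_norm' (a := fun p : Finset G × ℕ => 2 * C / ((p.2 + 1 : ℕ) : ℝ)) ?_ ?_
      · refine hU ?_
        filter_upwards [eventually_ge_atTop (({a} : Finset G), 0)] with p hp
        exact hinv p a (hp.1 (Finset.mem_singleton_self a)) h C hC
      · refine Tendsto.mono_left ?_ hU
        have h1 : Tendsto (fun n : ℕ => 2 * C / ((n + 1 : ℕ) : ℝ)) atTop (𝓝 0) :=
          (tendsto_const_div_atTop_nhds_zero_nat (2 * C)).comp (tendsto_add_atTop_nat 1)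
        rw [← prod_atTop_atTop_eq]
        exact h1.comp tendsto_snd
    have h1 := (key (fun g => h (g + a)) C fun g => hC _).sub (key h C hC)
    exact sub_eq_zero.1 (tendsto_nhds_unique h1 h0)

/-! ### Renorming a bounded action to an isometric one. -/

/-- A positive definite Hermitian form equivalent to the inner product of a Hilbert space is the
inner product of an isomorphic Hilbert space. -/
theorem exists_hilbert_of_form.{u} {H : Type u} [NormedAddCommGroup H] [InnerProductSpace ℂ H]
    [CompleteSpace H] (M : H → H → ℂ)
    (hsymm : ∀ f g, star (M g f) = M f g)
    (hadd : ∀ f g h, M (f + g) h = M f h + M g h)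
    (hsmul : ∀ f g (r : ℂ), M (r • f) g = star r * M f g)
    {c C : ℝ} (hc : 0 < c) (hC : 0 < C)
    (hlow : ∀ f, c ^ 2 * ‖f‖ ^ 2 ≤ (M f f).re) (hup : ∀ f, (M f f).re ≤ C ^ 2 * ‖f‖ ^ 2) :
    ∃ (H' : Type u) (_ : NormedAddCommGroup H') (_ : InnerProductSpace ℂ H')
      (_ : CompleteSpace H') (e : H ≃L[ℂ] H'),
      (∀ f g, inner ℂ (e f) (e g) = M f g) ∧ ∀ f, c * ‖f‖ ≤ ‖e f‖ ∧ ‖e f‖ ≤ C * ‖f‖ := by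
  -- An opaque copy of `H` that keeps only the linear structure, so that the new norm cannot clash
  -- with the old one.
  obtain ⟨H', iA, iM, e⟩ : ∃ (H' : Type u) (_ : AddCommGroup H') (_ : Module ℂ H'),
      Nonempty (H ≃ₗ[ℂ] H') := ⟨H, inferInstance, inferInstance, ⟨LinearEquiv.refl ℂ H⟩⟩
  obtain ⟨e⟩ := e
  let core : InnerProductSpace.Core ℂ H' :=
    { inner := fun x y => M (e.symm x) (e.symm y)
      conj_inner_symm := fun x y => hsymm _ _
      re_inner_nonneg := fun x => le_trans (by positivity) (hlow (e.symm x))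
      add_left := fun x y z => by
        rw [map_add, hadd]
      smul_left := fun x y r => by
        change M (e.symm (r • x)) _ = _
        rw [map_smul, hsmul]
        rfl
      definite := fun x hx => by
        change M (e.symm x) (e.symm x) = 0 at hx
        have h1 := hlow (e.symm x)
        rw [hx, Complex.zero_re] at h1
        have h2 : ‖e.symm x‖ ^ 2 ≤ 0 := by
          by_contra! h
          have : 0 < c ^ 2 * ‖e.symm x‖ ^ 2 := by positivity
          linarith
        have h3 : ‖e.symm x‖ = 0 := by
          have := sq_nonneg ‖e.symm x‖
          exact pow_eq_zero_iff (two_ne_zero) |>.1 (le_antisymm h2 this)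
        simpa using h3 }
  let _ : NormedAddCommGroup H' := core.toNormedAddCommGroup
  let _ : InnerProductSpace ℂ H' := InnerProductSpace.ofCore core.toCore
  have hinner : ∀ f g, inner ℂ (e f) (e g) = M f g := fun f g => by
    change M (e.symm (e f)) (e.symm (e g)) = M f g
    simp
  have hnorm : ∀ f, ‖e f‖ ^ 2 = (M f f).re := fun f => by
    rw [← hinner, ← inner_self_eq_norm_sq (𝕜 := ℂ)]
    rfl
  have hb1 : ∀ f, c * ‖f‖ ≤ ‖e f‖ := fun f => by
    have := hlow f
    rw [← hnorm, ← mul_pow] at this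
    exact le_of_sq_le_sq this (norm_nonneg _)
  have hb2 : ∀ f, ‖e f‖ ≤ C * ‖f‖ := fun f => by
    have := hup f
    rw [← hnorm, ← mul_pow] at this
    exact le_of_sq_le_sq this (by positivity)
  let e' : H ≃L[ℂ] H' := e.toContinuousLinearEquivOfBounds C c⁻¹ hb2 fun x => by
    have := hb1 (e.symm x)
    rw [e.apply_symm_apply] at this
    rw [inv_mul_eq_div, le_div_iff₀ hc, mul_comm]
    exact this
  have : CompleteSpace H' :=
    (completeSpace_congr (e := e'.toEquiv) e'.isUniformEmbedding).1 inferInstance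
  exact ⟨H', inferInstance, inferInstance, inferInstance, e', hinner, fun f => ⟨hb1 f, hb2 f⟩⟩

/-- A uniformly bounded projective action of an abelian group on a Hilbert space is isometric for
an equivalent Hilbert norm. -/
theorem exists_invariant_renorm.{u} {H : Type u} [NormedAddCommGroup H] [InnerProductSpace ℂ H]
    [CompleteSpace H] {G : Type*} [AddCommGroup G] (π : G → H →ₗ[ℂ] H) {C₀ : ℝ} (hC₀ : 1 ≤ C₀)
    (hup : ∀ z f, ‖π z f‖ ≤ C₀ * ‖f‖) (hlow : ∀ z f, ‖f‖ ≤ C₀ * ‖π z f‖)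
    (hmul : ∀ z w f g, inner ℂ (π z (π w f)) (π z (π w g)) =
      (inner ℂ (π (z + w) f) (π (z + w) g) : ℂ)) :
    ∃ (H' : Type u) (_ : NormedAddCommGroup H') (_ : InnerProductSpace ℂ H')
      (_ : CompleteSpace H') (e : H ≃L[ℂ] H'),
      (∀ z f, ‖e (π z f)‖ = ‖e f‖) ∧ ∀ f, C₀⁻¹ * ‖f‖ ≤ ‖e f‖ ∧ ‖e f‖ ≤ C₀ * ‖f‖ := by
  have hpos : 0 < C₀ := by linarith
  obtain ⟨m, hadd, hsmul, hstar, hK, hinv⟩ := exists_invariant_mean G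
  let φ : H → H → G → ℂ := fun f g z => inner ℂ (π z f) (π z g)
  have hbd : ∀ f g z, ‖φ f g z‖ ≤ (C₀ * ‖f‖) * (C₀ * ‖g‖) := fun f g z =>
    (norm_inner_le_norm _ _).trans
      (mul_le_mul (hup z f) (hup z g) (norm_nonneg _) (by positivity))
  have hre : ∀ f, (φ f f) = fun z => ((‖π z f‖ ^ 2 : ℝ) : ℂ) := fun f => by
    funext z
    simp [φ, inner_self_eq_norm_sq_to_K]
  have hs : ∀ f g, star (m (φ g f)) = m (φ f g) := by
    intro f g
    rw [← hstar (φ g f) _ (hbd g f)]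
    congr 1
    funext z
    exact inner_conj_symm _ _
  have ha : ∀ f g h, m (φ (f + g) h) = m (φ f h) + m (φ g h) := by
    intro f g h
    rw [← hadd (φ f h) (φ g h) (max ((C₀ * ‖f‖) * (C₀ * ‖h‖)) ((C₀ * ‖g‖) * (C₀ * ‖h‖)))
      (fun z => (hbd f h z).trans (le_max_left _ _)) (fun z => (hbd g h z).trans (le_max_right _ _))]
    congr 1
    funext z
    simp [φ]
  have hm : ∀ f g (r : ℂ), m (φ (r • f) g) = star r * m (φ f g) := by
    intro f g r
    rw [← hsmul (star r) (φ f g) _ (hbd f g)]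
    congr 1
    funext z
    simp [φ, mul_comm]
  have hl : ∀ f, C₀⁻¹ ^ 2 * ‖f‖ ^ 2 ≤ (m (φ f f)).re := by
    intro f
    -- The mean of a function with values in a closed half-plane stays there, so pointwise bounds on
    -- `‖π z f‖ ^ 2` pass to the average.
    refine hK {w : ℂ | C₀⁻¹ ^ 2 * ‖f‖ ^ 2 ≤ w.re} (φ f f) _ (hbd f f) ?_ ?_ fun z => ?_
    · exact convex_halfSpace_ge Complex.reLm.isLinear _
    · exact isClosed_le continuous_const Complex.continuous_re
    · rw [hre]
      change C₀⁻¹ ^ 2 * ‖f‖ ^ 2 ≤ ((‖π z f‖ ^ 2 : ℝ) : ℂ).re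
      rw [Complex.ofReal_re, ← mul_pow]
      gcongr
      rw [inv_mul_le_iff₀ hpos]
      exact hlow z f
  have hu : ∀ f, (m (φ f f)).re ≤ C₀ ^ 2 * ‖f‖ ^ 2 := by
    intro f
    refine hK {w : ℂ | w.re ≤ C₀ ^ 2 * ‖f‖ ^ 2} (φ f f) _ (hbd f f) ?_ ?_ fun z => ?_
    · exact convex_halfSpace_le Complex.reLm.isLinear _
    · exact isClosed_le Complex.continuous_re continuous_const
    · rw [hre]
      change ((‖π z f‖ ^ 2 : ℝ) : ℂ).re ≤ C₀ ^ 2 * ‖f‖ ^ 2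
      rw [Complex.ofReal_re, ← mul_pow]
      gcongr
      exact hup z f
  obtain ⟨H', i1, i2, i3, e, he, hn⟩ := exists_hilbert_of_form (fun f g => m (φ f g))
    hs ha hm (inv_pos.2 hpos) hpos hl hu
  refine ⟨H', i1, i2, i3, e, fun z f => ?_, hn⟩
  have h1 : (inner ℂ (e (π z f)) (e (π z f)) : ℂ) = inner ℂ (e f) (e f) := by
    rw [he, he]
    -- By `hmul`, replacing `f` by `π z f` only translates the averaged function, and the mean
    -- ignores translations.
    have : φ (π z f) (π z f) = fun w => φ f f (w + z) := by
      funext w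
      exact hmul w z f f
    simp only [this]
    exact hinv z (φ f f) _ (hbd f f)
  have h2 : ‖e (π z f)‖ ^ 2 = ‖e f‖ ^ 2 := by
    rw [← inner_self_eq_norm_sq (𝕜 := ℂ), ← inner_self_eq_norm_sq (𝕜 := ℂ), h1]
  exact (sq_eq_sq₀ (norm_nonneg _) (norm_nonneg _)).1 h2

/-! ### Derivatives of convolutions. -/

section ConvolutionDeriv

universe u

variable {E : Type u} [NormedAddCommGroup E] [InnerProductSpace ℝ E] [FiniteDimensional ℝ E]
  [MeasurableSpace E] [BorelSpace E]

/-- The iterated derivative of a convolution with a Schwartz function. -/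
theorem iteratedFDeriv_integral_smul_comp_sub {η : E → ℂ} (hη : Integrable η) (l : ℕ) :
    ∀ {V : Type u} [NormedAddCommGroup V] [NormedSpace ℝ V] [NormedSpace ℂ V]
      [IsScalarTower ℝ ℂ V] [CompleteSpace V] (φ : 𝓢(E, V)) (y : E),
      iteratedFDeriv ℝ l (fun y => ∫ x, η x • φ (y - x)) y =
        ∫ x, η x • iteratedFDeriv ℝ l φ (y - x) := by
  have hint : ∀ {V : Type u} [NormedAddCommGroup V] [NormedSpace ℝ V] [NormedSpace ℂ V]
      [IsScalarTower ℝ ℂ V] (f : E → V) (_ : Continuous f) (C : ℝ) (_ : ∀ x, ‖f x‖ ≤ C) (y : E),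
      Integrable (fun x => η x • f (y - x)) := by
    intro V _ _ _ _ f hf C hC y
    refine (hη.norm.mul_const C).mono' ?_ (Filter.Eventually.of_forall fun x => ?_)
    · exact hη.aestronglyMeasurable.smul (by fun_prop : Continuous fun x => f (y - x)).aestronglyMeasurable
    · rw [norm_smul]
      gcongr
      exact hC _
  -- The target `V` stays quantified in the induction, since the derivative of `φ` takes values in
  -- `E →L[ℝ] V`.
  induction l with
  | zero =>
    intro V _ _ _ _ _ φ y
    ext m
    rw [iteratedFDeriv_zero_apply]
    have : ∀ x, η x • iteratedFDeriv ℝ 0 φ (y - x) =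
        (continuousMultilinearCurryFin0 ℝ E V).symm (η x • φ (y - x)) := by
      intro x
      ext m
      simp
    simp_rw [this]
    have h := ((continuousMultilinearCurryFin0 ℝ E V).symm.toContinuousLinearEquiv).integral_comp_comm
      (μ := volume) (fun x => η x • φ (y - x))
    exact (congrArg (fun T : E [×0]→L[ℝ] V => T m) h).symm
  | succ l ih =>
    intro V _ _ _ _ _ φ y
    have hder : fderiv ℝ (fun y => ∫ x, η x • φ (y - x)) =
        fun y => ∫ x, η x • fderivCLM ℝ E V φ (y - x) := by
      funext y
      refine HasFDerivAt.fderiv ?_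
      refine (hasFDerivAt_integral_of_dominated_of_fderiv_le (s := Set.univ)
        (bound := fun x => ‖η x‖ * SchwartzMap.seminorm ℝ 0 0 (fderivCLM ℝ E V φ))
        (F' := fun y x => η x • fderivCLM ℝ E V φ (y - x)) Filter.univ_mem ?_ ?_ ?_ ?_ ?_ ?_)
      · exact Filter.Eventually.of_forall fun z =>
          (hint φ φ.continuous _ (norm_le_seminorm ℝ φ) z).aestronglyMeasurable
      · exact hint φ φ.continuous _ (norm_le_seminorm ℝ φ) y
      · exact (hint (fderivCLM ℝ E V φ) (SchwartzMap.continuous _) _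
          (norm_le_seminorm ℝ (fderivCLM ℝ E V φ)) y).aestronglyMeasurable
      · refine Filter.Eventually.of_forall fun x z _ => ?_
        rw [norm_smul]
        gcongr
        exact norm_le_seminorm ℝ _ _
      · exact hη.norm.mul_const _
      · refine Filter.Eventually.of_forall fun x z _ => ?_
        rw [fderivCLM_apply]
        have h := (φ.hasFDerivAt (z - x)).comp z ((hasFDerivAt_id z).sub_const x)
        exact h.const_smul (η x)
    rw [iteratedFDeriv_succ_eq_comp_right, hder, Function.comp_apply]
    have h := ih (fderivCLM ℝ E V φ) y
    have h2 := ((continuousMultilinearCurryRightEquiv' ℝ l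
      E V).symm.toContinuousLinearEquiv).integral_comp_comm (μ := volume)
      (fun x => η x • iteratedFDeriv ℝ l (fderivCLM ℝ E V φ) (y - x))
    refine (congrArg _ h).trans (h2.symm.trans ?_)
    congr 1
    funext x
    rw [iteratedFDeriv_succ_eq_comp_right, Function.comp_apply]
    ext m
    rfl

end ConvolutionDeriv

/-! ### Exchanging a tempered distribution with a convolution integral. -/

section Exchange

open scoped BoundedContinuousFunction

variable {E : Type} [NormedAddCommGroup E] [InnerProductSpace ℝ E]

/-- Bounded continuous functions, with the metric of the target taken from its norm. -/
abbrev NormedBCF (X V : Type*) [TopologicalSpace X] [NormedAddCommGroup V] := X →ᵇ V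

/-- The weighted derivative `y ↦ ‖y‖ ^ k • D^l φ(y)` of a Schwartz function, as a bounded
continuous function. -/
noncomputable def weightedDeriv (k l : ℕ) : 𝓢(E, ℂ) →ₗ[ℂ] NormedBCF E (E [×l]→L[ℝ] ℂ) where
  toFun φ := BoundedContinuousFunction.ofNormedAddCommGroup
    (fun y => (‖y‖ ^ k) • iteratedFDeriv ℝ l φ y)
    ((by fun_prop : Continuous fun y : E => ‖y‖ ^ k).smul
      ((φ.smooth l).continuous_iteratedFDeriv le_rfl))
    (SchwartzMap.seminorm ℝ k l φ)
    (fun y => by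
      rw [norm_smul, Real.norm_of_nonneg (by positivity)]
      exact le_seminorm ℝ k l φ y)
  map_add' φ ψ := by
    ext y : 1
    have h : iteratedFDeriv ℝ l (φ + ψ : 𝓢(E, ℂ)) y =
        iteratedFDeriv ℝ l φ y + iteratedFDeriv ℝ l ψ y :=
      iteratedFDeriv_add_apply (φ.contDiffAt l) (ψ.contDiffAt l)
    change ‖y‖ ^ k • iteratedFDeriv ℝ l (φ + ψ : 𝓢(E, ℂ)) y = _
    rw [h, smul_add]
    rfl
  map_smul' c φ := by
    ext y : 1
    have h : iteratedFDeriv ℝ l (c • φ : 𝓢(E, ℂ)) y = c • iteratedFDeriv ℝ l φ y :=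
      iteratedFDeriv_const_smul_apply (φ.contDiffAt l)
    change ‖y‖ ^ k • iteratedFDeriv ℝ l (c • φ : 𝓢(E, ℂ)) y = _
    rw [h, smul_comm]
    rfl

theorem weightedDeriv_apply (k l : ℕ) (φ : 𝓢(E, ℂ)) (y : E) :
    weightedDeriv k l φ y = (‖y‖ ^ k) • iteratedFDeriv ℝ l φ y := rfl

theorem seminorm_le_norm_weightedDeriv (k l : ℕ) (φ : 𝓢(E, ℂ)) :
    SchwartzMap.seminorm ℂ k l φ ≤ ‖weightedDeriv k l φ‖ := by
  refine seminorm_le_bound ℂ k l φ (norm_nonneg (weightedDeriv k l φ)) fun y => ?_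
  have h := (weightedDeriv k l φ).norm_coe_le_norm y
  rwa [weightedDeriv_apply, norm_smul, Real.norm_of_nonneg (by positivity)] at h

theorem iteratedFDeriv_compSubConstCLM (l : ℕ) (φ : 𝓢(E, ℂ)) (x y : E) :
    iteratedFDeriv ℝ l (compSubConstCLM ℂ x φ) y = iteratedFDeriv ℝ l φ (y - x) :=
  iteratedFDeriv_comp_sub l x y

theorem exists_norm_pow_mul_iteratedFDeriv_comp_sub_le (k l : ℕ) (φ : 𝓢(E, ℂ)) :
    ∃ C, 0 ≤ C ∧ ∀ x y, ‖y‖ ^ k * ‖iteratedFDeriv ℝ l φ (y - x)‖ ≤ C * (1 + ‖x‖) ^ k := by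
  refine ⟨2 ^ k * (Finset.Iic (k, l)).sup (fun m => SchwartzMap.seminorm ℝ m.1 m.2) φ,
    by positivity, fun x y => ?_⟩
  have h := one_add_le_sup_seminorm_apply (𝕜 := ℝ) (m := (k, l)) le_rfl le_rfl φ (y - x)
  -- A Peetre-type inequality: the weight at `y` costs the weight at `y - x` and a polynomial in
  -- `‖x‖`.
  have h2 : ‖y‖ ≤ (1 + ‖y - x‖) * (1 + ‖x‖) := by
    have := norm_sub_norm_le y x
    nlinarith [mul_nonneg (norm_nonneg (y - x)) (norm_nonneg x)]
  calc _ ≤ ((1 + ‖y - x‖) * (1 + ‖x‖)) ^ k * ‖iteratedFDeriv ℝ l φ (y - x)‖ := by gcongr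
    _ = (1 + ‖y - x‖) ^ k * ‖iteratedFDeriv ℝ l φ (y - x)‖ * (1 + ‖x‖) ^ k := by
      rw [mul_pow]; ring
    _ ≤ _ := by gcongr

theorem exists_norm_weightedDeriv_compSubConstCLM_le (k l : ℕ) (φ : 𝓢(E, ℂ)) :
    ∃ C, 0 ≤ C ∧ ∀ x, ‖weightedDeriv k l (compSubConstCLM ℂ x φ)‖ ≤ C * (1 + ‖x‖) ^ k := by
  obtain ⟨C, hC, h⟩ := exists_norm_pow_mul_iteratedFDeriv_comp_sub_le k l φ
  refine ⟨C, hC, fun x => (BoundedContinuousFunction.norm_le (by positivity)).2 fun y => ?_⟩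
  rw [weightedDeriv_apply, norm_smul, Real.norm_of_nonneg (by positivity),
    iteratedFDeriv_compSubConstCLM]
  exact h x y

theorem norm_smul_comp_const_sub_le {V : Type*} [NormedAddCommGroup V] [NormedSpace ℝ V]
    {f : E → V} (hf : Differentiable ℝ f) {c R : ℝ} (hc : 0 ≤ c) (y : E) {x₀ x : E}
    (hbound : ∀ z ∈ Metric.ball x₀ 1, c * ‖fderiv ℝ f (y - z)‖ ≤ R) (hx : x ∈ Metric.ball x₀ 1) :
    ‖c • f (y - x) - c • f (y - x₀)‖ ≤ R * ‖x - x₀‖ := by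
  have hder : ∀ z, HasFDerivAt (fun x => c • f (y - x))
      (c • (fderiv ℝ f (y - z)).comp (-.id ℝ E)) z := fun z =>
    ((hf (y - z)).hasFDerivAt.comp z ((hasFDerivAt_id z).const_sub y)).const_smul c
  refine (convex_ball x₀ 1).norm_image_sub_le_of_norm_hasFDerivWithin_le
    (fun z _ => (hder z).hasFDerivWithinAt) (fun z hz => ?_) (Metric.mem_ball_self one_pos) hx
  rw [ContinuousLinearMap.comp_neg, ContinuousLinearMap.comp_id, smul_neg, norm_neg, norm_smul,
    Real.norm_of_nonneg hc]
  exact hbound z hz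

/-- Translation is continuous into Schwartz space. -/
theorem continuous_weightedDeriv_compSubConstCLM (k l : ℕ) (φ : 𝓢(E, ℂ)) :
    Continuous fun x => weightedDeriv k l (compSubConstCLM ℂ x φ) := by
  obtain ⟨C, hC, h⟩ := exists_norm_pow_mul_iteratedFDeriv_comp_sub_le k (l + 1) φ
  rw [continuous_iff_continuousAt]
  intro x₀
  set R : ℝ := C * (1 + (‖x₀‖ + 1)) ^ k with hR
  have key : ∀ x ∈ Metric.ball x₀ 1, dist (weightedDeriv k l (compSubConstCLM ℂ x φ))
      (weightedDeriv k l (compSubConstCLM ℂ x₀ φ)) ≤ R * dist x x₀ := by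
    intro x hx
    rw [BoundedContinuousFunction.dist_le (by positivity)]
    intro y
    have h1 : Differentiable ℝ (iteratedFDeriv ℝ l φ) :=
      (φ.smooth ⊤).differentiable_iteratedFDeriv (by exact_mod_cast ENat.natCast_lt_top l)
    simp only [weightedDeriv_apply, iteratedFDeriv_compSubConstCLM]
    rw [dist_eq_norm, dist_eq_norm]
    refine norm_smul_comp_const_sub_le h1 (by positivity) y (fun z hz => ?_) hx
    rw [norm_fderiv_iteratedFDeriv]
    refine (h z y).trans ?_
    have : ‖z‖ ≤ ‖x₀‖ + 1 := by
      have := norm_le_norm_add_norm_sub' z x₀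
      rw [mem_ball_iff_norm] at hz
      linarith
    rw [hR]
    gcongr
  refine tendsto_iff_dist_tendsto_zero.2 ?_
  have h0 : Filter.Tendsto (fun x => R * dist x x₀) (nhds x₀) (nhds 0) := by
    have : Continuous fun x => R * dist x x₀ := by fun_prop
    simpa using this.tendsto x₀
  refine squeeze_zero' (Filter.Eventually.of_forall fun _ => dist_nonneg) ?_ h0
  filter_upwards [Metric.ball_mem_nhds x₀ one_pos] with x hx using key x hx

/-- A continuous linear functional on Schwartz space factors through finitely many weighted
derivatives. -/
theorem exists_factor_weightedDeriv (v : 𝓢(E, ℂ) →L[ℂ] ℂ) :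
    ∃ (s : Finset (ℕ × ℕ)) (g : ((i : s) → NormedBCF E (E [×i.1.2]→L[ℝ] ℂ)) →L[ℂ] ℂ),
      ∀ φ, v φ = g fun i => weightedDeriv i.1.1 i.1.2 φ := by
  obtain ⟨s, C, -, hC⟩ := Seminorm.bound_of_continuous (schwartz_withSeminorms ℂ E ℂ)
    ((normSeminorm ℂ ℂ).comp v.toLinearMap) (continuous_norm.comp v.continuous)
  let ι : 𝓢(E, ℂ) →ₗ[ℂ] ((i : s) → NormedBCF E (E [×i.1.2]→L[ℝ] ℂ)) :=
    LinearMap.pi fun i => weightedDeriv i.1.1 i.1.2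
  have hv : ∀ φ, ‖v φ‖ ≤ C * ‖ι φ‖ := by
    intro φ
    refine (hC φ).trans ?_
    change (C : ℝ) * (s.sup (schwartzSeminormFamily ℂ E ℂ)) φ ≤ _
    gcongr
    refine Seminorm.finset_sup_apply_le (norm_nonneg _) fun i hi => ?_
    exact (seminorm_le_norm_weightedDeriv i.1 i.2 φ).trans (norm_le_pi_norm (ι φ) ⟨i, hi⟩)
  -- By `hv`, `v` descends to a bounded functional on the range of `ι`; Hahn–Banach extends it to
  -- the whole Banach space.
  have hker : LinearMap.ker ι ≤ LinearMap.ker v.toLinearMap := by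
    intro φ hφ
    have h := hv φ
    rw [LinearMap.mem_ker.1 hφ, norm_zero, mul_zero] at h
    exact norm_le_zero_iff.1 h
  let w : LinearMap.range ι →ₗ[ℂ] ℂ :=
    ((LinearMap.ker ι).liftQ v.toLinearMap hker) ∘ₗ ι.quotKerEquivRange.symm.toLinearMap
  have hw : ∀ φ, w ⟨ι φ, LinearMap.mem_range_self ι φ⟩ = v φ := by
    intro φ
    simp [w, LinearMap.quotKerEquivRange_symm_apply_image]
  obtain ⟨g, hg, -⟩ := exists_extension_norm_eq (LinearMap.range ι)
    (w.mkContinuous C (by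
      rintro ⟨_, φ, rfl⟩
      rw [hw]
      exact hv φ))
  refine ⟨s, g, fun φ => ?_⟩
  have := hg ⟨ι φ, LinearMap.mem_range_self ι φ⟩
  rw [LinearMap.mkContinuous_apply, hw] at this
  exact this.symm

variable [FiniteDimensional ℝ E] [MeasurableSpace E] [BorelSpace E]

/-- The decay of `η` beats the polynomial growth of the translates. The convolution thus becomes a
Bochner integral in a Banach space, which commutes with bounded functionals. -/
theorem integrable_smul_weightedDeriv_compSubConstCLM (k l : ℕ) (η φ : 𝓢(E, ℂ)) :
    Integrable fun x => η x • weightedDeriv k l (compSubConstCLM ℂ x φ) := by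
  obtain ⟨C, hC, h⟩ := exists_norm_weightedDeriv_compSubConstCLM_le k l φ
  have hcont := continuous_weightedDeriv_compSubConstCLM k l φ
  have h1 : Integrable fun x => ‖x‖ ^ 0 * ‖η x‖ := η.integrable_pow_mul volume 0
  have h2 : Integrable fun x => ‖x‖ ^ k * ‖η x‖ := η.integrable_pow_mul volume k
  refine ((h1.add h2).const_mul (C * 2 ^ k)).mono'
    (η.continuous.smul hcont).aestronglyMeasurable (Filter.Eventually.of_forall fun x => ?_)
  rw [norm_smul]
  have h3 : (1 + ‖x‖) ^ k ≤ 2 ^ k * (1 + ‖x‖ ^ k) := by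
    rcases le_total ‖x‖ 1 with hx | hx
    · calc (1 + ‖x‖) ^ k ≤ 2 ^ k := by gcongr; linarith
        _ ≤ 2 ^ k * (1 + ‖x‖ ^ k) := le_mul_of_one_le_right (by positivity)
          (by linarith [pow_nonneg (norm_nonneg x) k])
    · calc (1 + ‖x‖) ^ k ≤ (2 * ‖x‖) ^ k := by gcongr; linarith
        _ = 2 ^ k * ‖x‖ ^ k := mul_pow _ _ _
        _ ≤ 2 ^ k * (1 + ‖x‖ ^ k) := by gcongr; linarith
  calc ‖η x‖ * ‖weightedDeriv k l (compSubConstCLM ℂ x φ)‖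
      ≤ ‖η x‖ * (C * (2 ^ k * (1 + ‖x‖ ^ k))) := by
        gcongr
        exact (h x).trans (by gcongr)
    _ = C * 2 ^ k * (‖x‖ ^ 0 * ‖η x‖ + ‖x‖ ^ k * ‖η x‖) := by ring

/-- A tempered distribution applied to a convolution is the integral of its values on the
translates. -/
theorem apply_convolution_eq_integral (v : 𝓢(E, ℂ) →L[ℂ] ℂ) (η φ Φ : 𝓢(E, ℂ))
    (hΦ : ∀ y, Φ y = ∫ x, η x * φ (y - x)) :
    v Φ = ∫ x, η x * v (compSubConstCLM ℂ x φ) := by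
  obtain ⟨s, g, hg⟩ := exists_factor_weightedDeriv v
  let F : E → (i : s) → NormedBCF E (E [×i.1.2]→L[ℝ] ℂ) := fun x i =>
    η x • weightedDeriv i.1.1 i.1.2 (compSubConstCLM ℂ x φ)
  have hF : Integrable F := Integrable.of_eval fun i =>
    integrable_smul_weightedDeriv_compSubConstCLM i.1.1 i.1.2 η φ
  have h1 : (fun i : s => weightedDeriv i.1.1 i.1.2 Φ) = ∫ x, F x := by
    funext i
    ext y : 1
    let L : ((i : s) → NormedBCF E (E [×i.1.2]→L[ℝ] ℂ)) →L[ℂ] (E [×i.1.2]→L[ℝ] ℂ) :=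
      (BoundedContinuousFunction.evalCLM ℂ y).comp (ContinuousLinearMap.proj i)
    have h2 : (∫ x, F x) i y = ∫ x, L (F x) := (L.integral_comp_comm hF).symm
    have h3 : ∀ x, L (F x) = ‖y‖ ^ i.1.1 • η x • iteratedFDeriv ℝ i.1.2 φ (y - x) := by
      intro x
      change η x • (‖y‖ ^ i.1.1 • iteratedFDeriv ℝ i.1.2 (compSubConstCLM ℂ x φ) y) = _
      rw [iteratedFDeriv_compSubConstCLM, smul_comm]
    rw [h2, weightedDeriv_apply]
    simp_rw [h3]
    rw [integral_smul, ← iteratedFDeriv_integral_smul_comp_sub η.integrable]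
    congr 2
    funext z
    exact hΦ z
  rw [hg, h1, ← g.integral_comp_comm hF]
  congr 1
  funext x
  rw [hg, ← smul_eq_mul, ← map_smul]
  rfl

end Exchange

/-! ### Moving convolutions and multiplications across an invariant form. -/

section InvariantForm

open scoped FourierTransform

variable {E : Type} [NormedAddCommGroup E] [InnerProductSpace ℝ E]

/-- Pointwise product of Schwartz functions. -/
noncomputable abbrev schwartzMul (f : 𝓢(E, ℂ)) : 𝓢(E, ℂ) →L[ℂ] 𝓢(E, ℂ) :=
  pairing (ContinuousLinearMap.mul ℂ ℂ) f

/-- The reflection `f(-·)` of a Schwartz function. -/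
noncomputable abbrev schwartzReflect (f : 𝓢(E, ℂ)) : 𝓢(E, ℂ) :=
  compCLMOfContinuousLinearEquiv ℂ (ContinuousLinearEquiv.neg ℝ (M := E)) f

theorem schwartzMul_apply (f g : 𝓢(E, ℂ)) (x : E) : schwartzMul f g x = f x * g x := rfl

theorem schwartzReflect_apply (f : 𝓢(E, ℂ)) (x : E) : schwartzReflect f x = f (-x) := rfl

variable [FiniteDimensional ℝ E] [MeasurableSpace E] [BorelSpace E]

/-- Convolution of Schwartz functions. -/
noncomputable abbrev schwartzConv (f : 𝓢(E, ℂ)) : 𝓢(E, ℂ) →L[ℂ] 𝓢(E, ℂ) :=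
  convolution (ContinuousLinearMap.mul ℂ ℂ) f

theorem schwartzConv_apply (f g : 𝓢(E, ℂ)) (y : E) :
    schwartzConv f g y = ∫ x, f x * g (y - x) :=
  convolution_apply (ContinuousLinearMap.mul ℂ ℂ) f g y

/-- Both sides are integrals of `β` over translates. Translating both arguments by `x` moves the
shift to the other argument with opposite sign, which is why `k` gets reflected. -/
theorem form_conv_symm (β : 𝓢(E, ℂ) →ₗ[ℂ] 𝓢(E, ℂ) →ₗ[ℂ] ℂ)
    (h₁ : ∀ ψ, Continuous fun φ => β φ ψ) (h₂ : ∀ φ, Continuous (β φ))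
    (htr : ∀ x φ ψ, β (compSubConstCLM ℂ x φ) (compSubConstCLM ℂ x ψ) = β φ ψ)
    (k φ ψ : 𝓢(E, ℂ)) :
    β (schwartzConv k φ) ψ = β φ (schwartzConv (schwartzReflect k) ψ) := by
  have e1 := apply_convolution_eq_integral ⟨β.flip ψ, h₁ ψ⟩ k φ (schwartzConv k φ)
    (schwartzConv_apply k φ)
  have e2 := apply_convolution_eq_integral ⟨β φ, h₂ φ⟩ (schwartzReflect k) ψ
    (schwartzConv (schwartzReflect k) ψ) (schwartzConv_apply _ ψ)
  change β (schwartzConv k φ) ψ = ∫ x, k x * β (compSubConstCLM ℂ x φ) ψ at e1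
  change β φ (schwartzConv (schwartzReflect k) ψ) =
    ∫ x, k (-x) * β φ (compSubConstCLM ℂ x ψ) at e2
  rw [e1, e2, ← integral_neg_eq_self]
  congr 1
  funext x
  rw [← htr x, compSubConstCLM_comp, neg_add_cancel, compSubConstCLM_zero]
  rfl

theorem fourier_schwartzConv (k φ : 𝓢(E, ℂ)) :
    𝓕 (schwartzConv k φ) = schwartzMul (𝓕 k) (𝓕 φ) :=
  fourier_convolution _ _ _

theorem fourierInv_schwartzConv_reflect (k φ : 𝓢(E, ℂ)) :
    𝓕⁻ (schwartzConv (schwartzReflect k) φ) = schwartzMul (𝓕 k) (𝓕⁻ φ) := by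
  ext y
  have h : 𝓕⁻ (schwartzReflect k) y = 𝓕 k y := by
    have h0 : (fun x => schwartzReflect k (-x)) = k := by
      funext x
      rw [schwartzReflect_apply, neg_neg]
    rw [fourierInv_coe, Real.fourierInv_eq_fourier_comp_neg, fourier_coe, h0]
  rw [schwartzMul_apply, fourierInv_apply_eq, fourier_schwartzConv, ← h]
  rfl

theorem fourier_compSubConstCLM (x y : E) (φ : 𝓢(E, ℂ)) :
    𝓕 (compSubConstCLM ℂ x φ) y =
      Complex.exp (Complex.I * ((inner ℝ y (-(2 * Real.pi) • x) : ℝ) : ℂ)) * 𝓕 φ y := by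
  rw [fourier_coe, fourier_coe, Real.fourier_eq', Real.fourier_eq',
    ← integral_add_right_eq_self _ x, ← integral_const_mul]
  congr 1
  funext v
  simp only [compSubConstCLM_apply, add_sub_cancel_right, smul_eq_mul, ← mul_assoc,
    ← Complex.exp_add]
  congr 2
  rw [inner_add_left, inner_smul_right, real_inner_comm x y]
  push_cast
  ring

theorem fourierInv_compSubConstCLM (x y : E) (φ : 𝓢(E, ℂ)) :
    𝓕⁻ (compSubConstCLM ℂ x φ) y =
      Complex.exp (Complex.I * ((inner ℝ y ((2 * Real.pi) • x) : ℝ) : ℂ)) * 𝓕⁻ φ y := by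
  rw [fourierInv_coe, fourierInv_coe, Real.fourierInv_eq_fourier_neg,
    Real.fourierInv_eq_fourier_neg, ← fourier_coe, ← fourier_coe, fourier_compSubConstCLM]
  simp

/-- Conjugation by Fourier turns this into `form_conv_symm`. Taking `𝓕` in one argument and `𝓕⁻` in
the other makes a common translation act by opposite modulations, as `hmod` requires. -/
theorem form_mul_symm (β : 𝓢(E, ℂ) →ₗ[ℂ] 𝓢(E, ℂ) →ₗ[ℂ] ℂ)
    (h₁ : ∀ ψ, Continuous fun φ => β φ ψ) (h₂ : ∀ φ, Continuous (β φ))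
    (hmod : ∀ (ξ : E) (φ φ' ψ ψ' : 𝓢(E, ℂ)),
      (∀ y, φ' y = Complex.exp (Complex.I * ((inner ℝ y ξ : ℝ) : ℂ)) * φ y) →
      (∀ y, ψ' y = Complex.exp (Complex.I * ((inner ℝ y (-ξ) : ℝ) : ℂ)) * ψ y) →
      β φ' ψ' = β φ ψ)
    (η φ ψ : 𝓢(E, ℂ)) :
    β (schwartzMul η φ) ψ = β φ (schwartzMul η ψ) := by
  let F : 𝓢(E, ℂ) →L[ℂ] 𝓢(E, ℂ) := FourierTransform.fourierCLM ℂ 𝓢(E, ℂ)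
  let Fi : 𝓢(E, ℂ) →L[ℂ] 𝓢(E, ℂ) := FourierTransform.fourierInvCLM ℂ 𝓢(E, ℂ)
  have h := form_conv_symm (β.compl₁₂ F.toLinearMap Fi.toLinearMap)
    (fun ψ => (h₁ (Fi ψ)).comp F.continuous) (fun φ => (h₂ (F φ)).comp Fi.continuous)
    (fun x φ ψ => hmod (-(2 * Real.pi) • x) (𝓕 φ) (𝓕 (compSubConstCLM ℂ x φ)) (𝓕⁻ ψ)
      (𝓕⁻ (compSubConstCLM ℂ x ψ)) (fun y => fourier_compSubConstCLM x y φ) fun y => by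
        rw [← neg_smul, neg_neg]
        exact fourierInv_compSubConstCLM x y ψ) (𝓕⁻ η) (𝓕⁻ φ) (𝓕 ψ)
  change β (𝓕 (schwartzConv (𝓕⁻ η) (𝓕⁻ φ))) (𝓕⁻ (𝓕 ψ)) =
    β (𝓕 (𝓕⁻ φ)) (𝓕⁻ (schwartzConv (schwartzReflect (𝓕⁻ η)) (𝓕 ψ))) at h
  rw [fourier_schwartzConv, fourierInv_schwartzConv_reflect] at h
  simpa only [FourierTransform.fourier_fourierInv_eq, FourierTransform.fourierInv_fourier_eq] using h

/-- The rank one operators `φ ↦ (∫ b φ) a` are compositions of multiplications and convolutions. -/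
theorem form_rank_one (β : 𝓢(E, ℂ) →ₗ[ℂ] 𝓢(E, ℂ) →ₗ[ℂ] ℂ)
    (hconv : ∀ k φ ψ, β (schwartzConv k φ) ψ = β φ (schwartzConv (schwartzReflect k) ψ))
    (hmul : ∀ η φ ψ, β (schwartzMul η φ) ψ = β φ (schwartzMul η ψ))
    (a b k : 𝓢(E, ℂ)) (hk : ∀ x y, a y ≠ 0 → b x ≠ 0 → k (y - x) = 1) (φ ψ : 𝓢(E, ℂ)) :
    (∫ x, b x * φ x) * β a ψ = (∫ x, a x * ψ x) * β φ b := by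
  -- The composite has kernel `a y * k (y - x) * b x`, and `k = 1` wherever the outer factors are
  -- nonzero.
  have h1 : schwartzMul a (schwartzConv k (schwartzMul b φ)) = (∫ x, b x * φ x) • a := by
    ext y
    rw [schwartzMul_apply, schwartzConv_apply, smul_apply, smul_eq_mul, mul_comm]
    by_cases hy : a y = 0
    · simp [hy]
    congr 1
    rw [← integral_sub_left_eq_self _ volume y]
    congr 1
    funext x
    rw [sub_sub_cancel, schwartzMul_apply]
    by_cases hx : b x = 0
    · simp [hx]
    rw [hk x y hy hx, one_mul]
  have h2 : schwartzMul b (schwartzConv (schwartzReflect k) (schwartzMul a ψ)) =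
      (∫ x, a x * ψ x) • b := by
    ext y
    rw [schwartzMul_apply, schwartzConv_apply, smul_apply, smul_eq_mul, mul_comm]
    by_cases hy : b y = 0
    · simp [hy]
    congr 1
    rw [← integral_sub_left_eq_self _ volume y]
    congr 1
    funext x
    rw [sub_sub_cancel, schwartzMul_apply, schwartzReflect_apply, neg_sub]
    by_cases hx : a x = 0
    · simp [hx]
    rw [hk y x hx hy, one_mul]
  have h3 : β (schwartzMul a (schwartzConv k (schwartzMul b φ))) ψ =
      β φ (schwartzMul b (schwartzConv (schwartzReflect k) (schwartzMul a ψ))) := by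
    rw [hmul, hconv, hmul]
  rw [h1, h2] at h3
  simpa using h3

end InvariantForm

/-! ### Density of compactly supported functions in Schwartz space. -/

section Density

variable {E : Type} [NormedAddCommGroup E] [InnerProductSpace ℝ E] [FiniteDimensional ℝ E]

/-- A smooth cutoff which is `1` on the ball of radius `R`. -/
theorem exists_schwartz_cutoff (R : ℝ) (hR : 0 < R) :
    ∃ χ : 𝓢(E, ℂ), HasCompactSupport χ ∧ (∀ x, ‖x‖ ≤ R → χ x = 1) ∧
      ∀ x, ∃ r : ℝ, 0 ≤ r ∧ χ x = r := by
  let f : ContDiffBump (0 : E) := ⟨R, R + 1, hR, by linarith⟩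
  have h₁ : HasCompactSupport (Complex.ofRealCLM ∘ f) := f.hasCompactSupport.comp_left rfl
  have h₂ : ContDiff ℝ ((⊤ : ℕ∞) : WithTop ℕ∞) (Complex.ofRealCLM ∘ f) :=
    Complex.ofRealCLM.contDiff.comp f.contDiff
  refine ⟨h₁.toSchwartzMap h₂, h₁, fun x hx => ?_, fun x => ⟨f x, f.nonneg, rfl⟩⟩
  change ((f x : ℝ) : ℂ) = 1
  rw [f.one_of_mem_closedBall (by simpa using hx), Complex.ofReal_one]

/-- Compactly supported functions are sequentially dense in Schwartz space. -/
theorem exists_seq_hasCompactSupport_tendsto (a : 𝓢(E, ℂ)) :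
    ∃ u : ℕ → 𝓢(E, ℂ), (∀ n, HasCompactSupport (u n)) ∧
      Filter.Tendsto u Filter.atTop (nhds a) := by
  obtain ⟨χ, hχs, hχ1, -⟩ := exists_schwartz_cutoff (E := E) 1 one_pos
  let c : ℕ → ℝ := fun n => ((n : ℝ) + 1)⁻¹
  have hc : ∀ n, 0 < c n := fun n => by positivity
  have hc1 : ∀ n, c n ≤ 1 := fun n => inv_le_one_of_one_le₀ (by linarith [Nat.cast_nonneg (α := ℝ) n])
  let e : ℕ → E ≃L[ℝ] E := fun n =>
    ContinuousLinearEquiv.smulLeft (Units.mk0 (c n) (hc n).ne')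
  let X : ℕ → 𝓢(E, ℂ) := fun n => compCLMOfContinuousLinearEquiv ℂ (e n) χ
  have hX : ∀ n y, X n y = χ (c n • y) := fun n y => rfl
  let g : E → ℂ := fun y => χ y - 1
  have hg : ∀ i : ℕ, ContDiff ℝ i g := fun i => (χ.smooth i).sub contDiff_const
  have hM : ∀ i : ℕ, ∃ M, 0 ≤ M ∧ ∀ y, ‖iteratedFDeriv ℝ i g y‖ ≤ M := by
    intro i
    refine ⟨SchwartzMap.seminorm ℝ 0 i χ + 1, by positivity, fun y => ?_⟩
    have : iteratedFDeriv ℝ i g y =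
        iteratedFDeriv ℝ i χ y - iteratedFDeriv ℝ i (fun _ : E => (1 : ℂ)) y :=
      iteratedFDeriv_sub_apply (χ.contDiffAt i) contDiffAt_const
    rw [this]
    refine (norm_sub_le _ _).trans (add_le_add (norm_iteratedFDeriv_le_seminorm ℝ χ i y) ?_)
    rcases Nat.eq_zero_or_pos i with rfl | hi
    · simp
    · rw [iteratedFDeriv_const_of_ne hi.ne']
      simp
  choose M hM0 hM using hM
  have hgn : ∀ n (i : ℕ) y, ‖iteratedFDeriv ℝ i (fun y => g (c n • y)) y‖ ≤ M i := by
    intro n i y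
    rw [iteratedFDeriv_comp_const_smul (c n) (hg i)]
    refine (norm_smul_le (c n ^ i) (iteratedFDeriv ℝ i g (c n • y))).trans ?_
    rw [Real.norm_of_nonneg (pow_nonneg (hc n).le i)]
    exact (mul_le_of_le_one_left (norm_nonneg _) (pow_le_one₀ (hc n).le (hc1 n))).trans (hM i _)
  refine ⟨fun n => schwartzMul (X n) a, fun n => ?_, ?_⟩
  · have : HasCompactSupport (X n) := hχs.comp_homeomorph (e n).toHomeomorph
    exact this.mul_right
  rw [(schwartz_withSeminorms ℝ E ℂ).tendsto_nhds]
  rintro ⟨k, l⟩ ε hε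
  set K : ℝ := ∑ i ∈ Finset.range (l + 1),
    (l.choose i : ℝ) * M i * SchwartzMap.seminorm ℝ (k + 1) (l - i) a with hK
  have hK0 : 0 ≤ K := Finset.sum_nonneg fun i _ => by
    have := hM0 i
    positivity
  have key : ∀ n, SchwartzMap.seminorm ℝ k l (schwartzMul (X n) a - a) ≤ K * c n := by
    intro n
    refine seminorm_le_bound ℝ k l _ (mul_nonneg hK0 (hc n).le) fun y => ?_
    have hfun : (⇑(schwartzMul (X n) a - a) : E → ℂ) = fun y => g (c n • y) * a y := by
      funext y
      change X n y * a y - a y = (χ (c n • y) - 1) * a y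
      rw [hX]
      ring
    rw [hfun]
    -- Near such `y` the error vanishes identically; elsewhere `1 ≤ c n * ‖y‖` gains the factor `c
    -- n` at the price of one more power of `‖y‖`, hence the `k + 1` in `K`.
    rcases lt_or_ge (c n * ‖y‖) 1 with hy | hy
    · have hzero : (fun y => g (c n • y) * a y) =ᶠ[nhds y] fun _ => 0 := by
        have hopen : IsOpen {y : E | c n * ‖y‖ < 1} :=
          isOpen_lt (by fun_prop) continuous_const
        filter_upwards [hopen.mem_nhds hy] with z hz
        have : χ (c n • z) = 1 := hχ1 _ (by
          rw [norm_smul, Real.norm_of_nonneg (hc n).le]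
          exact hz.le)
        simp [g, this]
      have h0 : iteratedFDeriv ℝ l (fun y => g (c n • y) * a y) y =
          iteratedFDeriv ℝ l (fun _ : E => (0 : ℂ)) y :=
        (hzero.iteratedFDeriv ℝ l).eq_of_nhds
      have h1 : iteratedFDeriv ℝ l (fun _ : E => (0 : ℂ)) = 0 := iteratedFDeriv_fun_zero
      rw [h0, h1]
      simpa using mul_nonneg hK0 (hc n).le
    · have hcd : ContDiff ℝ l (fun y => g (c n • y)) := (hg l).comp (contDiff_const_smul _)
      have h1 := norm_iteratedFDeriv_mul_le hcd (a.smooth l) y le_rfl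
      calc ‖y‖ ^ k * ‖iteratedFDeriv ℝ l (fun y => g (c n • y) * a y) y‖
          ≤ ‖y‖ ^ k * (∑ i ∈ Finset.range (l + 1), (l.choose i : ℝ) *
            ‖iteratedFDeriv ℝ i (fun y => g (c n • y)) y‖ * ‖iteratedFDeriv ℝ (l - i) a y‖) := by
            gcongr
        _ ≤ (c n * ‖y‖) * (‖y‖ ^ k * (∑ i ∈ Finset.range (l + 1), (l.choose i : ℝ) *
            M i * ‖iteratedFDeriv ℝ (l - i) a y‖)) := by
            refine le_trans ?_ (le_mul_of_one_le_left ?_ hy)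
            · gcongr with i hi
              exact hgn n i y
            · refine mul_nonneg (by positivity) (Finset.sum_nonneg fun i _ => ?_)
              have := hM0 i
              positivity
        _ = c n * ∑ i ∈ Finset.range (l + 1), (l.choose i : ℝ) *
            M i * (‖y‖ ^ (k + 1) * ‖iteratedFDeriv ℝ (l - i) a y‖) := by
            simp only [Finset.mul_sum]
            refine Finset.sum_congr rfl fun i _ => ?_
            ring
        _ ≤ K * c n := by
            rw [mul_comm, hK]
            refine mul_le_mul_of_nonneg_right ?_ (hc n).le
            refine Finset.sum_le_sum fun i _ => ?_
            have := hM0 i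
            gcongr
            exact le_seminorm ℝ (k + 1) (l - i) a y
  have hlim : Filter.Tendsto (fun n => K * c n) Filter.atTop (nhds 0) := by
    have : Filter.Tendsto c Filter.atTop (nhds 0) := by
      simpa [c, one_div] using tendsto_one_div_add_atTop_nhds_zero_nat (𝕜 := ℝ)
    simpa using this.const_mul K
  filter_upwards [hlim.eventually (gt_mem_nhds hε)] with n hn
  exact (key n).trans_lt hn

end Density

/-! ### Classification of invariant forms. -/

section Classification

variable {E : Type} [NormedAddCommGroup E] [InnerProductSpace ℝ E] [FiniteDimensional ℝ E]
  [MeasurableSpace E] [BorelSpace E]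

/-- A separately continuous bilinear form on Schwartz space which is invariant under translations
and modulations is a multiple of `∫ φ ψ`. -/
theorem exists_form_eq_integral (β : 𝓢(E, ℂ) →ₗ[ℂ] 𝓢(E, ℂ) →ₗ[ℂ] ℂ)
    (h₁ : ∀ ψ, Continuous fun φ => β φ ψ) (h₂ : ∀ φ, Continuous (β φ))
    (htr : ∀ x φ ψ, β (compSubConstCLM ℂ x φ) (compSubConstCLM ℂ x ψ) = β φ ψ)
    (hmod : ∀ (ξ : E) (φ φ' ψ ψ' : 𝓢(E, ℂ)),
      (∀ y, φ' y = Complex.exp (Complex.I * ((inner ℝ y ξ : ℝ) : ℂ)) * φ y) →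
      (∀ y, ψ' y = Complex.exp (Complex.I * ((inner ℝ y (-ξ) : ℝ) : ℂ)) * ψ y) →
      β φ' ψ' = β φ ψ) :
    ∃ c : ℂ, ∀ φ ψ, β φ ψ = c * ∫ x, φ x * ψ x := by
  have hconv := form_conv_symm β h₁ h₂ htr
  have hmul := form_mul_symm β h₁ h₂ hmod
  obtain ⟨b, hbs, hb1, hbr⟩ := exists_schwartz_cutoff (E := E) 1 one_pos
  have hb : (∫ x, b x * b x) ≠ 0 := by
    have h : ∀ x, b x * b x = ((‖b x‖ ^ 2 : ℝ) : ℂ) := fun x => by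
      obtain ⟨r, hr, hx⟩ := hbr x
      rw [hx, Complex.norm_real, Real.norm_of_nonneg hr]
      push_cast
      ring
    simp_rw [h]
    rw [integral_complex_ofReal, Complex.ofReal_ne_zero]
    refine ne_of_gt (Continuous.integral_pos_of_hasCompactSupport_nonneg_nonzero (x := 0)
      (by fun_prop) ?_ (fun x => by positivity) ?_)
    · exact hbs.norm.comp_left (g := fun r : ℝ => r ^ 2) (by simp)
    · rw [hb1 0 (by simp)]
      simp
  have hcs : ∀ a : 𝓢(E, ℂ), HasCompactSupport a → ∀ ψ,
      β a ψ = (β b b / ∫ x, b x * b x) * ∫ x, a x * ψ x := by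
    intro a ha ψ
    obtain ⟨R₁, hR₁⟩ := ha.isCompact.isBounded.exists_norm_le
    obtain ⟨R₂, hR₂⟩ := hbs.isCompact.isBounded.exists_norm_le
    -- The radius exceeds every `‖y - x‖` with `a y ≠ 0` and `b x ≠ 0`; the maxima and `+ 1` keep it
    -- positive even if a support is empty.
    obtain ⟨k, -, hk, -⟩ := exists_schwartz_cutoff (E := E) (max R₁ 0 + max R₂ 0 + 1) (by positivity)
    have h := form_rank_one β hconv hmul a b k (fun x y hy hx => hk _ ?_) b ψ
    · rw [div_mul_eq_mul_div, eq_div_iff hb]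
      linear_combination h
    · have e1 := hR₁ y (subset_tsupport _ hy)
      have e2 := hR₂ x (subset_tsupport _ hx)
      have := norm_sub_le y x
      have := le_max_left R₁ 0
      have := le_max_left R₂ 0
      linarith
  refine ⟨β b b / ∫ x, b x * b x, fun φ ψ => ?_⟩
  obtain ⟨u, hu, hlim⟩ := exists_seq_hasCompactSupport_tendsto φ
  refine tendsto_nhds_unique (((h₁ ψ).tendsto φ).comp hlim) ?_
  have hI : Continuous fun φ : 𝓢(E, ℂ) => ∫ x, φ x * ψ x :=
    (integralCLM ℂ volume).continuous.comp
      (pairing_continuous_left (ContinuousLinearMap.mul ℂ ℂ) ψ)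
  refine Filter.Tendsto.congr (fun n => (hcs (u n) (hu n) ψ).symm) ?_
  exact ((hI.tendsto φ).comp hlim).const_mul _

end Classification

/-! ### Extending a proportional correspondence by completeness. -/

/-- If `a` and `b` have proportional norms, `a` has dense range and `b` takes values in a complete
space, then the partial correspondence `a z ↔ b z` extends to the whole space. -/
theorem exists_partner_of_denseRange {Z X Y W : Type*} [AddCommGroup Z] [NormedAddCommGroup X]
    [NormedAddCommGroup Y] [CompleteSpace Y] [TopologicalSpace W] [T2Space W] (a : Z →+ X)
    (b : Z →+ Y) (ha : DenseRange a) {r : ℝ} (hr : ∀ z, ‖b z‖ = r * ‖a z‖) {p : X → W} {q : Y → W}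
    (hp : Continuous p) (hq : Continuous q) (hpq : ∀ z, p (a z) = q (b z)) (x : X) :
    ∃ y, p x = q y ∧ ‖y‖ = r * ‖x‖ := by
  obtain ⟨s, hs, hlim⟩ := mem_closure_iff_seq_limit.1 (ha x)
  choose z hz using hs
  obtain rfl : (fun n => a (z n)) = s := funext hz
  have hc : CauchySeq fun n => b (z n) := by
    rw [cauchySeq_iff_tendsto_dist_atTop_0]
    have h := (cauchySeq_iff_tendsto_dist_atTop_0.1 hlim.cauchySeq).const_mul r
    rw [mul_zero] at h
    refine h.congr fun n => ?_
    rw [dist_eq_norm, dist_eq_norm, ← map_sub, ← map_sub, hr]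
  obtain ⟨y, hy⟩ := cauchySeq_tendsto_of_complete hc
  refine ⟨y, ?_, ?_⟩
  · refine tendsto_nhds_unique ((hp.tendsto x).comp hlim) ?_
    exact ((hq.tendsto y).comp hy).congr fun n => (hpq (z n)).symm
  · refine tendsto_nhds_unique hy.norm ?_
    exact (hlim.norm.const_mul r).congr fun n => (hr (z n)).symm

/-! ### Riesz representatives of Schwartz functions and their form. -/

section Riesz

variable {E : Type*} [NormedAddCommGroup E] [NormedSpace ℝ E]
variable {H : Type*} [NormedAddCommGroup H] [InnerProductSpace ℂ H] [CompleteSpace H]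

/-- Complex conjugation on Schwartz space. -/
noncomputable def schwartzConj : 𝓢(E, ℂ) →L[ℝ] 𝓢(E, ℂ) :=
  postcompCLM (𝕜 := ℝ) (Complex.conjCLE : ℂ →L[ℝ] ℂ)

theorem schwartzConj_apply (φ : 𝓢(E, ℂ)) (x : E) : schwartzConj φ x = star (φ x) := rfl

theorem schwartzConj_conj (φ : 𝓢(E, ℂ)) : schwartzConj (schwartzConj φ) = φ := by
  ext x
  simp [schwartzConj_apply]

theorem schwartzConj_smul (c : ℂ) (φ : 𝓢(E, ℂ)) :
    schwartzConj (c • φ) = star c • schwartzConj φ := by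
  ext x
  simp [schwartzConj_apply]

/-- The Riesz representative `T φ` of the functional `f ↦ ⟨J f, conj φ⟩`. -/
noncomputable def rieszMap (J : H →L[ℂ] 𝓢'(E, ℂ)) : 𝓢(E, ℂ) →ₗ[ℂ] H where
  toFun φ := (InnerProductSpace.toDual ℂ H).symm
    ((PointwiseConvergenceCLM.evalCLM (RingHom.id ℂ) ℂ (schwartzConj φ)).comp J)
  map_add' φ ψ := by
    rw [← map_add]
    congr 1
    ext f
    rw [map_add]
    exact map_add (J f) _ _
  -- The inverse Riesz isomorphism is conjugate linear; conjugating `φ` compensates and makes the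
  -- map linear.
  map_smul' c φ := by
    rw [RingHom.id_apply]
    refine ext_inner_right ℂ fun f => ?_
    rw [inner_smul_left, InnerProductSpace.toDual_symm_apply, InnerProductSpace.toDual_symm_apply,
      schwartzConj_smul]
    exact map_smul (J f) _ _

theorem inner_rieszMap_left (J : H →L[ℂ] 𝓢'(E, ℂ)) (φ : 𝓢(E, ℂ)) (f : H) :
    inner ℂ (rieszMap J φ) f = J f (schwartzConj φ) :=
  InnerProductSpace.toDual_symm_apply

/-- A vector orthogonal to the range has `J f = 0` as a distribution, so it vanishes by injectivity.
-/
theorem denseRange_rieszMap (J : H →L[ℂ] 𝓢'(E, ℂ)) (hJ : Function.Injective J) :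
    DenseRange (rieszMap J) := by
  have h : (LinearMap.range (rieszMap J)).topologicalClosure = ⊤ := by
    rw [Submodule.topologicalClosure_eq_top_iff, Submodule.eq_bot_iff]
    intro f hf
    apply hJ
    rw [map_zero]
    ext φ
    have := (Submodule.mem_orthogonal _ _).1 hf (rieszMap J (schwartzConj φ))
      (LinearMap.mem_range_self _ _)
    rw [inner_rieszMap_left, schwartzConj_conj] at this
    simpa using this
  have h2 := (Submodule.dense_iff_topologicalClosure_eq_top).2 h
  exact h2

/-- The Riesz form is invariant under the transpose of an isometric symmetry. -/
theorem apply_rieszMap_invariant (J : H →L[ℂ] 𝓢'(E, ℂ)) (hJ : Function.Injective J)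
    {A A' : 𝓢(E, ℂ) → 𝓢(E, ℂ)} (hA : ∀ φ, A' (A φ) = φ)
    (hU : ∀ f, ∃ g, (∀ φ, J g φ = J f (A φ)) ∧ ‖g‖ = ‖f‖)
    (hV : ∀ f, ∃ g, ∀ φ, J g φ = J f (A' φ))
    {φ φ' ψ ψ' : 𝓢(E, ℂ)} (hφ : φ' = A φ) (hψ : schwartzConj ψ' = A (schwartzConj ψ)) :
    J (rieszMap J ψ') φ' = J (rieszMap J ψ) φ := by
  choose U hU hUn using hU
  choose V hV using hV
  let U' : H →ₗᵢ[ℂ] H :=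
    { toFun := U
      map_add' := fun f g => hJ (by ext φ; simp [hU])
      map_smul' := fun c f => hJ (by ext φ; simp [hU])
      norm_map' := hUn }
  have hUV : ∀ f, U (V f) = f := fun f => hJ (by ext φ; rw [hU, hV, hA])
  -- `U` is an isometry with right inverse `V`, so pairing with `f = U (V f)` moves `U` off the
  -- representative.
  have key : U (rieszMap J ψ') = rieszMap J ψ := by
    refine ext_inner_right ℂ fun f => ?_
    have h : inner ℂ (U (rieszMap J ψ')) (U (V f)) = inner ℂ (rieszMap J ψ') (V f) :=
      U'.inner_map_map _ _
    rw [hUV, inner_rieszMap_left, hψ, hV, hA] at h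
    rw [h, inner_rieszMap_left]
  rw [hφ, ← hU, key]

/-- The form `⟨J T ψ, φ⟩` attached to a Hilbert space of tempered distributions. -/
noncomputable def rieszForm (J : H →L[ℂ] 𝓢'(E, ℂ)) : 𝓢(E, ℂ) →ₗ[ℂ] 𝓢(E, ℂ) →ₗ[ℂ] ℂ :=
  LinearMap.mk₂ ℂ (fun φ ψ => J (rieszMap J ψ) φ)
    (fun φ φ' ψ => map_add (J (rieszMap J ψ)) φ φ')
    (fun c φ ψ => map_smul (J (rieszMap J ψ)) c φ)
    (fun φ ψ ψ' => by rw [map_add, map_add]; rfl)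
    (fun c φ ψ => by rw [map_smul, map_smul]; rfl)

theorem rieszForm_apply (J : H →L[ℂ] 𝓢'(E, ℂ)) (φ ψ : 𝓢(E, ℂ)) :
    rieszForm J φ ψ = J (rieszMap J ψ) φ := rfl

theorem inner_rieszMap_rieszMap (J : H →L[ℂ] 𝓢'(E, ℂ)) (φ ψ : 𝓢(E, ℂ)) :
    inner ℂ (rieszMap J φ) (rieszMap J ψ) = rieszForm J (schwartzConj φ) ψ :=
  inner_rieszMap_left J φ _

theorem continuous_rieszForm_left (J : H →L[ℂ] 𝓢'(E, ℂ)) (ψ : 𝓢(E, ℂ)) :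
    Continuous fun φ => rieszForm J φ ψ :=
  map_continuous (J (rieszMap J ψ))

/-- Hermitian symmetry of the inner product reduces this to continuity in the other argument. -/
theorem continuous_rieszForm_right (J : H →L[ℂ] 𝓢'(E, ℂ)) (φ : 𝓢(E, ℂ)) :
    Continuous (rieszForm J φ) := by
  have h : ∀ ψ, rieszForm J φ ψ =
      star (J (rieszMap J (schwartzConj φ)) (schwartzConj ψ)) := fun ψ => by
    rw [← inner_rieszMap_left, ← schwartzConj_conj φ, ← inner_rieszMap_rieszMap,
      schwartzConj_conj]
    exact (inner_conj_symm _ _).symm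
  have h2 : Continuous fun ψ => star (J (rieszMap J (schwartzConj φ)) (schwartzConj ψ)) :=
    continuous_star.comp ((map_continuous (J (rieszMap J (schwartzConj φ)))).comp
      schwartzConj.continuous)
  exact h2.congr fun ψ => (h ψ).symm

end Riesz

/-! ### The isometric case. -/

section Unitary

variable {d : ℕ}

theorem translateTD_apply (x : EuclideanSpace ℝ (Fin d)) (f : 𝓢'(EuclideanSpace ℝ (Fin d), ℂ))
    (φ : 𝓢(EuclideanSpace ℝ (Fin d), ℂ)) :
    translateTD x f φ = f (compSubConstCLM ℂ (-x) φ) := rfl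

theorem modulateTD_apply (ξ : EuclideanSpace ℝ (Fin d)) (f : 𝓢'(EuclideanSpace ℝ (Fin d), ℂ))
    (φ : 𝓢(EuclideanSpace ℝ (Fin d), ℂ)) :
    modulateTD ξ f φ = f (SchwartzMap.smulLeftCLM ℂ (expChar ξ) φ) := rfl

theorem smulLeftCLM_expChar_apply (ξ : EuclideanSpace ℝ (Fin d))
    (φ : 𝓢(EuclideanSpace ℝ (Fin d), ℂ)) (y : EuclideanSpace ℝ (Fin d)) :
    SchwartzMap.smulLeftCLM ℂ (expChar ξ) φ y = expChar ξ y * φ y :=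
  smulLeftCLM_apply_apply (expChar_hasTemperateGrowth ξ) φ y

theorem expChar_add (ξ η y : EuclideanSpace ℝ (Fin d)) :
    expChar (ξ + η) y = expChar ξ y * expChar η y := by
  simp only [expChar, ← Complex.exp_add, inner_add_right]
  push_cast
  ring_nf

theorem expChar_zero (y : EuclideanSpace ℝ (Fin d)) : expChar 0 y = 1 := by
  simp [expChar]

theorem star_expChar (ξ y : EuclideanSpace ℝ (Fin d)) : star (expChar ξ y) = expChar (-ξ) y := by
  simp [expChar, ← Complex.exp_conj]

theorem translateTD_zero (f : 𝓢'(EuclideanSpace ℝ (Fin d), ℂ)) : translateTD 0 f = f := by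
  ext φ
  rw [translateTD_apply, neg_zero, compSubConstCLM_zero]
  rfl

theorem modulateTD_zero (f : 𝓢'(EuclideanSpace ℝ (Fin d), ℂ)) : modulateTD 0 f = f := by
  ext φ
  rw [modulateTD_apply]
  congr 1
  ext y
  rw [smulLeftCLM_expChar_apply, expChar_zero, one_mul]

variable {H : Type*} [NormedAddCommGroup H] [InnerProductSpace ℂ H] [CompleteSpace H]

/-- For isometric translations and modulations the Riesz form is a multiple of the `L²` pairing. -/
theorem exists_rieszForm_eq_integral (J : H →L[ℂ] 𝓢'(EuclideanSpace ℝ (Fin d), ℂ))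
    (hJ : Function.Injective J)
    (hinv : ∀ (f : H) (x ξ : EuclideanSpace ℝ (Fin d)),
      ∃ g : H, J g = modulateTD ξ (translateTD x (J f)) ∧ ‖g‖ = ‖f‖) :
    ∃ c : ℂ, ∀ φ ψ, rieszForm J φ ψ = c * ∫ x, φ x * ψ x := by
  have htr : ∀ (f : H) (x : EuclideanSpace ℝ (Fin d)),
      ∃ g : H, (∀ φ, J g φ = J f (compSubConstCLM ℂ x φ)) ∧ ‖g‖ = ‖f‖ := fun f x => by
    obtain ⟨g, hg, hn⟩ := hinv f (-x) 0
    refine ⟨g, fun φ => ?_, hn⟩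
    rw [hg, modulateTD_zero, translateTD_apply, neg_neg]
  have hmod : ∀ (f : H) (ξ : EuclideanSpace ℝ (Fin d)),
      ∃ g : H, (∀ φ, J g φ = J f (SchwartzMap.smulLeftCLM ℂ (expChar ξ) φ)) ∧ ‖g‖ = ‖f‖ :=
    fun f ξ => by
      obtain ⟨g, hg, hn⟩ := hinv f 0 ξ
      refine ⟨g, fun φ => ?_, hn⟩
      rw [hg, translateTD_zero, modulateTD_apply]
  have h₁ : ∀ x φ ψ,
      rieszForm J (compSubConstCLM ℂ x φ) (compSubConstCLM ℂ x ψ) = rieszForm J φ ψ := by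
    intro x φ ψ
    simp only [rieszForm_apply]
    refine apply_rieszMap_invariant J hJ (A := fun φ => compSubConstCLM ℂ x φ)
      (A' := fun φ => compSubConstCLM ℂ (-x) φ)
      (fun φ => ?_) (fun f => htr f x) (fun f => (htr f (-x)).imp fun _ h => h.1) rfl ?_
    · rw [compSubConstCLM_comp, add_neg_cancel, compSubConstCLM_zero]
      rfl
    · ext y
      rfl
  have h₂ : ∀ (ξ : EuclideanSpace ℝ (Fin d))
      (φ φ' ψ ψ' : 𝓢(EuclideanSpace ℝ (Fin d), ℂ)),
      (∀ y, φ' y = expChar ξ y * φ y) → (∀ y, ψ' y = expChar (-ξ) y * ψ y) →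
      rieszForm J φ' ψ' = rieszForm J φ ψ := by
    intro ξ φ φ' ψ ψ' hφ hψ
    simp only [rieszForm_apply]
    refine apply_rieszMap_invariant J hJ
      (A := fun φ => SchwartzMap.smulLeftCLM ℂ (expChar ξ) φ)
      (A' := fun φ => SchwartzMap.smulLeftCLM ℂ (expChar (-ξ)) φ)
      (fun φ => ?_) (fun f => hmod f ξ) (fun f => (hmod f (-ξ)).imp fun _ h => h.1) ?_ ?_
    · ext y
      rw [smulLeftCLM_expChar_apply, smulLeftCLM_expChar_apply, ← mul_assoc, ← expChar_add,
        neg_add_cancel, expChar_zero, one_mul]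
    · ext y
      rw [smulLeftCLM_expChar_apply, hφ]
    · ext y
      rw [smulLeftCLM_expChar_apply, schwartzConj_apply, schwartzConj_apply, hψ, star_mul',
        star_expChar, neg_neg]
  exact exists_form_eq_integral (rieszForm J) (continuous_rieszForm_left J)
    (continuous_rieszForm_right J) h₁ h₂

/-- A Hilbert space of tempered distributions with isometric translations and modulations is
`L²`, up to a constant factor of the norm. -/
theorem exists_norm_eq_mul_of_isometric [Nontrivial H]
    (J : H →L[ℂ] 𝓢'(EuclideanSpace ℝ (Fin d), ℂ)) (hJ : Function.Injective J)
    (hinv : ∀ (f : H) (x ξ : EuclideanSpace ℝ (Fin d)),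
      ∃ g : H, J g = modulateTD ξ (translateTD x (J f)) ∧ ‖g‖ = ‖f‖) :
    ∃ C : ℝ, 0 < C ∧
      (∀ f : H, ∃ u : Lp ℂ 2 (volume : Measure (EuclideanSpace ℝ (Fin d))),
        J f = Lp.toTemperedDistribution u ∧ ‖f‖ = C * ‖u‖) ∧
      (∀ u : Lp ℂ 2 (volume : Measure (EuclideanSpace ℝ (Fin d))), ∃ f : H,
        J f = Lp.toTemperedDistribution u ∧ ‖f‖ = C * ‖u‖) := by
  obtain ⟨c, hc⟩ := exists_rieszForm_eq_integral J hJ hinv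
  let b : 𝓢(EuclideanSpace ℝ (Fin d), ℂ) →L[ℂ]
      Lp ℂ 2 (volume : Measure (EuclideanSpace ℝ (Fin d))) := toLpCLM ℂ ℂ 2 volume
  have hnorm : ∀ ψ, ((‖rieszMap J ψ‖ ^ 2 : ℝ) : ℂ) = c * ((‖b ψ‖ ^ 2 : ℝ) : ℂ) := by
    intro ψ
    have e1 : (inner ℂ (rieszMap J ψ) (rieszMap J ψ) : ℂ) = ((‖rieszMap J ψ‖ ^ 2 : ℝ) : ℂ) := by
      rw [inner_self_eq_norm_sq_to_K]
      push_cast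
      rfl
    have e2 : (inner ℂ (b ψ) (b ψ) : ℂ) = ((‖b ψ‖ ^ 2 : ℝ) : ℂ) := by
      rw [inner_self_eq_norm_sq_to_K]
      push_cast
      rfl
    have e3 : (inner ℂ (b ψ) (b ψ) : ℂ) = ∫ x, inner ℂ (ψ x) (ψ x) :=
      inner_toL2_toL2_eq ψ ψ
    rw [← e1, ← e2, e3, inner_rieszMap_rieszMap, hc]
    congr 2
    funext x
    rw [schwartzConj_apply, RCLike.inner_apply, mul_comm]
    rfl
  obtain ⟨φ₀, hφ₀⟩ : ∃ φ, rieszMap J φ ≠ 0 := by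
    by_contra! h
    obtain ⟨f, hf⟩ := exists_ne (0 : H)
    refine hf (hJ ?_)
    rw [map_zero]
    ext φ
    have := inner_rieszMap_left J (schwartzConj φ) f
    rw [h, inner_zero_left, schwartzConj_conj] at this
    exact this.symm
  -- `c` is a ratio of squared norms at `φ₀`, hence positive; `φ₀` exists because `H` is nontrivial.
  obtain ⟨r, hr, hcr⟩ : ∃ r : ℝ, 0 < r ∧ c = ((r ^ 2 : ℝ) : ℂ) := by
    have h0 := hnorm φ₀
    have hpos : 0 < ‖rieszMap J φ₀‖ := norm_pos_iff.2 hφ₀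
    have hb : ‖b φ₀‖ ≠ 0 := fun h => by
      rw [h] at h0
      have : ‖rieszMap J φ₀‖ ^ 2 = 0 := by
        apply Complex.ofReal_injective
        rw [h0]
        simp
      exact hpos.ne' (pow_eq_zero_iff two_ne_zero |>.1 this)
    refine ⟨‖rieszMap J φ₀‖ / ‖b φ₀‖, div_pos hpos (by positivity), ?_⟩
    rw [div_pow, Complex.ofReal_div, h0, mul_div_cancel_right₀]
    exact_mod_cast pow_ne_zero 2 hb
  have hc0 : c ≠ 0 := by
    rw [hcr]
    exact_mod_cast (pow_pos hr 2).ne'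
  -- The factor `c⁻¹` makes `J (a ψ)` the distribution `ψ` itself. Since `‖rieszMap J ψ‖ = r * ‖b
  -- ψ‖` and `c = r ^ 2`, norms scale by `r⁻¹`.
  let a : 𝓢(EuclideanSpace ℝ (Fin d), ℂ) →ₗ[ℂ] H := c⁻¹ • rieszMap J
  have hab : ∀ ψ, ‖a ψ‖ = r⁻¹ * ‖b ψ‖ := by
    intro ψ
    have h1 : ‖rieszMap J ψ‖ = r * ‖b ψ‖ := by
      have h := hnorm ψ
      rw [hcr, ← Complex.ofReal_mul, ← mul_pow] at h
      exact (pow_left_inj₀ (norm_nonneg _) (by positivity) two_ne_zero).1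
        (Complex.ofReal_injective h)
    change ‖c⁻¹ • rieszMap J ψ‖ = _
    rw [norm_smul, h1, hcr, norm_inv, Complex.norm_real, Real.norm_of_nonneg (by positivity)]
    field_simp
  have ha : DenseRange a := by
    have h := denseRange_rieszMap J hJ
    exact (Homeomorph.smulOfNeZero c⁻¹ (inv_ne_zero hc0)).surjective.denseRange.comp h
      (Homeomorph.smulOfNeZero c⁻¹ (inv_ne_zero hc0)).continuous
  have hb : DenseRange b := denseRange_toLpCLM ENNReal.ofNat_ne_top
  let q := Lp.toTemperedDistributionCLM ℂ (volume : Measure (EuclideanSpace ℝ (Fin d))) 2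
  have hJab : ∀ ψ, J (a ψ) = q (b ψ) := by
    intro ψ
    change J (c⁻¹ • rieszMap J ψ) = Lp.toTemperedDistribution (ψ.toLp 2 volume)
    rw [map_smul, Lp.toTemperedDistribution_toLp_eq]
    ext φ
    refine Eq.trans ?_ (toTemperedDistributionCLM_apply_apply volume ψ φ).symm
    change c⁻¹ * rieszForm J φ ψ = ∫ x, φ x * ψ x
    rw [hc, inv_mul_cancel_left₀ hc0]
  refine ⟨r⁻¹, inv_pos.2 hr, fun f => ?_, fun u => ?_⟩
  · obtain ⟨u, hu, hn⟩ := exists_partner_of_denseRange a.toAddMonoidHom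
      b.toLinearMap.toAddMonoidHom ha (r := r) (fun ψ => by
        change ‖b ψ‖ = r * ‖a ψ‖
        rw [hab, mul_inv_cancel_left₀ hr.ne']) J.continuous q.continuous hJab f
    exact ⟨u, hu, by rw [hn, inv_mul_cancel_left₀ hr.ne']⟩
  · obtain ⟨f, hf, hn⟩ := exists_partner_of_denseRange b.toLinearMap.toAddMonoidHom
      a.toAddMonoidHom hb (r := r⁻¹) hab q.continuous J.continuous (fun ψ => (hJab ψ).symm) u
    exact ⟨f, hf.symm, hn⟩

end Unitary

/-! ### Time-frequency shifts and the general case. -/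

section Main

variable {d : ℕ}

theorem expChar_apply_add (ξ x y : EuclideanSpace ℝ (Fin d)) :
    expChar ξ (x + y) = expChar ξ x * expChar ξ y := by
  simp only [expChar, ← Complex.exp_add, inner_add_left]
  push_cast
  ring_nf

theorem norm_expChar (ξ y : EuclideanSpace ℝ (Fin d)) : ‖expChar ξ y‖ = 1 := by
  rw [expChar, mul_comm, Complex.norm_exp_ofReal_mul_I]

/-- Time-frequency shifts compose up to a phase. -/
theorem modulateTD_translateTD_comp (x y ξ η : EuclideanSpace ℝ (Fin d))
    (u : 𝓢'(EuclideanSpace ℝ (Fin d), ℂ)) :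
    modulateTD ξ (translateTD x (modulateTD η (translateTD y u))) =
      expChar η (-x) • modulateTD (ξ + η) (translateTD (x + y) u) := by
  ext φ
  change u (compSubConstCLM ℂ (-y) (SchwartzMap.smulLeftCLM ℂ (expChar η)
      (compSubConstCLM ℂ (-x) (SchwartzMap.smulLeftCLM ℂ (expChar ξ) φ)))) =
    expChar η (-x) • u (compSubConstCLM ℂ (-(x + y))
      (SchwartzMap.smulLeftCLM ℂ (expChar (ξ + η)) φ))
  have h : compSubConstCLM ℂ (-y) (SchwartzMap.smulLeftCLM ℂ (expChar η)
      (compSubConstCLM ℂ (-x) (SchwartzMap.smulLeftCLM ℂ (expChar ξ) φ))) =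
      expChar η (-x) • compSubConstCLM ℂ (-(x + y))
        (SchwartzMap.smulLeftCLM ℂ (expChar (ξ + η)) φ) := by
    ext t
    rw [smul_apply, compSubConstCLM_apply, smulLeftCLM_expChar_apply, compSubConstCLM_apply,
      smulLeftCLM_expChar_apply, compSubConstCLM_apply, smulLeftCLM_expChar_apply, smul_eq_mul]
    have e1 : t - -y - -x = t + x + y := by abel
    have e2 : t - -(x + y) = t + x + y := by abel
    have e3 : t - -y = -x + (t + x + y) := by abel
    rw [e1, e2, e3, expChar_apply_add η (-x), expChar_add]
    ring
  rw [h]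
  exact map_smul u _ _

/-- The projective action of phase space by time-frequency shifts. -/
theorem exists_timeFrequencyShift {H : Type*} [NormedAddCommGroup H] [InnerProductSpace ℂ H]
    (J : H →L[ℂ] 𝓢'(EuclideanSpace ℝ (Fin d), ℂ)) (hJ : Function.Injective J) {C₀ : ℝ}
    (hinv : ∀ (f : H) (x ξ : EuclideanSpace ℝ (Fin d)),
      ∃ g : H, J g = modulateTD ξ (translateTD x (J f)) ∧ ‖g‖ ≤ C₀ * ‖f‖) :
    ∃ π : EuclideanSpace ℝ (Fin d) × EuclideanSpace ℝ (Fin d) → H →ₗ[ℂ] H,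
      (∀ z f, J (π z f) = modulateTD z.2 (translateTD z.1 (J f))) ∧
      (∀ z f, ‖π z f‖ ≤ C₀ * ‖f‖) ∧ (∀ z f, ‖f‖ ≤ C₀ * ‖π z f‖) ∧
      ∀ z w f g, inner ℂ (π z (π w f)) (π z (π w g)) =
        (inner ℂ (π (z + w) f) (π (z + w) g) : ℂ) := by
  choose P hP hPn using hinv
  let π : EuclideanSpace ℝ (Fin d) × EuclideanSpace ℝ (Fin d) → H →ₗ[ℂ] H := fun z =>
    { toFun := fun f => P f z.1 z.2
      map_add' := fun f g => hJ (by simp only [hP, map_add])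
      map_smul' := fun c f => hJ (by simp only [hP, map_smul, RingHom.id_apply]) }
  have hπ : ∀ z f, J (π z f) = modulateTD z.2 (translateTD z.1 (J f)) := fun z f => hP f z.1 z.2
  have hcomp : ∀ z w f, π z (π w f) = expChar w.2 (-z.1) • π (z + w) f := fun z w f => hJ (by
    rw [hπ, hπ, modulateTD_translateTD_comp, map_smul, hπ]
    rfl)
  refine ⟨π, hπ, fun z f => hPn f z.1 z.2, fun z f => ?_, fun z w f g => ?_⟩
  · have h1 : π 0 f = f := hJ (by
      rw [hπ, Prod.fst_zero, Prod.snd_zero, translateTD_zero, modulateTD_zero])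
    -- `π (-z)` inverts `π z` up to a phase, so the upper bound for `-z` is the lower bound for `z`.
    have h2 : ‖π (-z) (π z f)‖ = ‖f‖ := by
      rw [hcomp, neg_add_cancel, h1, norm_smul, norm_expChar, one_mul]
    rw [← h2]
    exact hPn (π z f) _ _
  · rw [hcomp, hcomp, inner_smul_left, inner_smul_right, ← mul_assoc, Complex.conj_mul',
      norm_expChar]
    simp

end Main

theorem theorem1p3 (d : ℕ)
    {H : Type*} [NormedAddCommGroup H] [InnerProductSpace ℂ H] [CompleteSpace H] [Nontrivial H]
    -- the continuous embedding of `H` into the tempered distributions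
    (J : H →L[ℂ] 𝓢'(EuclideanSpace ℝ (Fin d), ℂ)) (hJ : Function.Injective J)
    (C₀ : ℝ) (hC₀ : 1 ≤ C₀)
    -- `e^{i⟨·, ξ⟩} f(· - x)` lies in `H`, with norm at most `C₀ ‖f‖`
    (hinv : ∀ (f : H) (x ξ : EuclideanSpace ℝ (Fin d)),
      ∃ g : H, J g = modulateTD ξ (translateTD x (J f)) ∧ ‖g‖ ≤ C₀ * ‖f‖) :
    -- `H` and `L²(ℝ^d)` are the same set of tempered distributions
    Set.range J = Set.range
      (Lp.toTemperedDistribution :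
        Lp ℂ 2 (volume : Measure (EuclideanSpace ℝ (Fin d))) → 𝓢'(EuclideanSpace ℝ (Fin d), ℂ)) ∧
    ∃ C : ℝ, 0 < C ∧
      ∀ (f : H) (u : Lp ℂ 2 (volume : Measure (EuclideanSpace ℝ (Fin d)))),
        J f = Lp.toTemperedDistribution u →
          C₀⁻¹ * C * ‖u‖ ≤ ‖f‖ ∧ ‖f‖ ≤ C₀ * C * ‖u‖ := by
  have hpos : 0 < C₀ := by linarith
  obtain ⟨π, hπ, hup, hlow, hmul⟩ := exists_timeFrequencyShift J hJ hinv
  obtain ⟨H', _, _, _, e, heinv, he⟩ := exists_invariant_renorm π hC₀ hup hlow hmul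
  have : Nontrivial H' := e.toEquiv.symm.nontrivial
  have hJe : Function.Injective (J.comp (e.symm : H' →L[ℂ] H)) := hJ.comp e.symm.injective
  obtain ⟨C, hC, hHL, hLH⟩ := exists_norm_eq_mul_of_isometric (J.comp (e.symm : H' →L[ℂ] H)) hJe
    (fun f x ξ => ⟨e (π (x, ξ) (e.symm f)), by
      change J (e.symm (e (π (x, ξ) (e.symm f)))) = _
      rw [e.symm_apply_apply, hπ]
      rfl, by rw [heinv, e.apply_symm_apply]⟩)
  have hJ' : ∀ f, J.comp (e.symm : H' →L[ℂ] H) (e f) = J f := fun f =>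
    congrArg J (e.symm_apply_apply f)
  refine ⟨Set.ext fun T => ⟨?_, ?_⟩, C, hC, fun f u hfu => ?_⟩
  · rintro ⟨f, rfl⟩
    obtain ⟨u, hu, -⟩ := hHL (e f)
    exact ⟨u, by rw [← hu, hJ']⟩
  · rintro ⟨u, rfl⟩
    obtain ⟨f, hf, -⟩ := hLH u
    exact ⟨e.symm f, hf⟩
  · obtain ⟨f', hf', hn⟩ := hLH u
    obtain rfl : f' = e f := hJe (by rw [hf', hJ', hfu])
    -- With `‖e f‖ = C * ‖u‖`, the renorming bounds lose a single factor `C₀` on each side.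
    obtain ⟨h1, h2⟩ := he f
    rw [hn] at h1 h2
    constructor
    · rw [mul_assoc, inv_mul_le_iff₀ hpos]
      exact h2
    · rw [inv_mul_le_iff₀ hpos] at h1
      rw [mul_assoc]
      exact h1
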